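/- Let $n\ge 0$ be an integer. For a kernel $u:\{-n,\dots,n\}\to\mathbb R$ and $f\in\ell^2(\mathbb Z)$ (real-valued) put $(u*f)(k)=\sum_{\ell=-n}^{n}u(\ell)f(k-\ell)$ and $(\Delta f)(k)=f(k+2)-2f(k+1)+f(k)$. Let $T_k$ be the $k$th Chebyshev polynomial of the first kind, let $$S_n(x)=\frac{1}{x-1}\cdot\frac{2\sin\left(\frac{\pi}{2n+2}\right)}{(n+1)\left(1+\cos\left(\frac{\pi}{2n+2}\right)\right)}\cdot T_{n+1}\!\left(\frac{1+\cos\left(\frac{\pi}{2n+2}\right)}{2}(x+1)-1\right),$$ and define the kernel $u_n:\{-n,\dots,n\}\to\mathbb R$ by $$u_n(k)=\frac1\pi\int_{-1}^{1}S_n(x)\,T_{|k|}(x)\,\frac{dx}{\sqrt{1-x^2}}.$$ Then $\sum_{k=-n}^{n}u_n(k)=1$, and for every kernel $u:\{-n,\dots,n\}\to\mathbb R$ with $\sum_{k=-n}^{n}u(k)=1$ the supremum below is finite and $$\sup_{0\ne f\in\ell^2(\mathbb Z)}\frac{\|\Delta(u*f)\|_{\ell^2(\mathbb Z)}}{\|f\|_{\ell^2(\mathbb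 Z)}}\;\ge\;\frac{4}{n+1}\cdot\frac{\sin\left(\frac{\pi}{2n+2}\right)}{1+\cos\left(\frac{\pi}{2n+2}\right)},$$ with equality if and only if $u=u_n$. -/

import Mathlib

noncomputable section

namespace SmoothestAverage

/-- A kernel `u : {-n, …, n} → ℝ`. -/
abbrev Kernel (n : ℕ) : Type := Finset.Icc (-(n : ℤ)) (n : ℤ) → ℝ

/-- The real Hilbert space `ℓ²(ℤ)`. -/
abbrev EllTwo : Type := lp (fun _ : ℤ => ℝ) 2

/-- A kernel is normalized if its values sum to `1`. -/
def Kernel.IsNormalized {n : ℕ} (u : Kernel n) : Prop := ∑ l, u l = 1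

/-- The convolution `(u ∗ f)(k) = ∑_{ℓ = -n}^{n} u(ℓ) f(k - ℓ)`. -/
def conv {n : ℕ} (u : Kernel n) (f : ℤ → ℝ) : ℤ → ℝ :=
  fun k => ∑ l, u l * f (k - (l : ℤ))

/-- The discrete Laplacian `(Δ f)(k) = f(k+2) - 2 f(k+1) + f(k)`. -/
def laplacian (f : ℤ → ℝ) : ℤ → ℝ :=
  fun k => f (k + 2) - 2 * f (k + 1) + f k

theorem memlp_shift {f : ℤ → ℝ} (hf : Memℓp f 2) (a : ℤ) :
    Memℓp (fun k => f (k + a)) 2 := by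
  have h2 : 0 < (2 : ENNReal).toReal := by norm_num
  rw [memℓp_gen_iff h2] at hf ⊢
  exact hf.comp_injective (add_left_injective a)

theorem memlp_conv {n : ℕ} (u : Kernel n) {f : ℤ → ℝ} (hf : Memℓp f 2) :
    Memℓp (conv u f) 2 := by
  unfold conv
  refine Memℓp.finsetSum (E := fun _ : ℤ => ℝ) Finset.univ
    (f := fun l k => u l * f (k - (l : ℤ))) fun l _ => ?_
  have h := (memlp_shift hf (-(l : ℤ))).const_smul (u l)
  exact h

theorem memlp_laplacian {f : ℤ → ℝ} (hf : Memℓp f 2) : Memℓp (laplacian f) 2 :=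
  ((memlp_shift hf 2).sub ((memlp_shift hf 1).const_smul (2 : ℝ))).add hf

/-- The element `Δ(u ∗ f)` of `ℓ²(ℤ)`, for `f` in `ℓ²(ℤ)`. -/
def smoothedLaplacian {n : ℕ} (u : Kernel n) (f : EllTwo) : EllTwo :=
  ⟨laplacian (conv u f), memlp_laplacian (memlp_conv u (lp.memℓp f))⟩

/-- The set of ratios `‖Δ(u ∗ f)‖ / ‖f‖`, where `f` runs over the nonzero elements of `ℓ²(ℤ)`. -/
def ratios {n : ℕ} (u : Kernel n) : Set ℝ :=
  {r | ∃ f : EllTwo, f ≠ 0 ∧ r = ‖smoothedLaplacian u f‖ / ‖f‖}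

/-- The constant `C₂(u) = sup_{0 ≠ f ∈ ℓ²(ℤ)} ‖Δ(u ∗ f)‖ / ‖f‖`. -/
def smoothingConstant {n : ℕ} (u : Kernel n) : ℝ := sSup (ratios u)

/-- `S_n(x) = 1/(x-1) · 2 sin(π/(2n+2)) / ((n+1)(1 + cos(π/(2n+2)))) ·
T_{n+1}((1 + cos(π/(2n+2)))/2 · (x+1) - 1)`; this agrees with a polynomial of degree `n` at every
`x ≠ 1`, and the value at the single point `x = 1` does not matter for the integral below. -/
def S (n : ℕ) (x : ℝ) : ℝ :=
  1 / (x - 1) *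
    (2 * Real.sin (Real.pi / (2 * n + 2)) /
      ((n + 1) * (1 + Real.cos (Real.pi / (2 * n + 2))))) *
    (Polynomial.Chebyshev.T ℝ ((n : ℤ) + 1)).eval
      ((1 + Real.cos (Real.pi / (2 * n + 2))) / 2 * (x + 1) - 1)

/-- The symmetric kernel
`u_n(k) = (1/π) ∫_{-1}^{1} S_n(x) T_{|k|}(x) dx / √(1 - x²)`. -/
def optimalKernel (n : ℕ) : Kernel n := fun k =>
  1 / Real.pi *
    ∫ x in (-1 : ℝ)..1,
      S n x * (Polynomial.Chebyshev.T ℝ |(k : ℤ)|).eval x / Real.sqrt (1 - x ^ 2)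

end SmoothestAverage

end

noncomputable section

namespace SmoothestAverage

/-! ### The norm of `f ↦ Δ(u ∗ f)` as the supremum of its Fourier multiplier. -/

section Operator

/-! On the Fourier side `f ↦ Δ(u ∗ f)` is multiplication by a function of modulus `(2 - 2 cos θ)
|symbol u θ|`, whose supremum is the operator norm (`norm_smoothedLaplacian_le`,
`symbol_le_of_norm_smoothedLaplacian_le`). With `x = cos θ`, the real part of the symbol is `p(x)`
for a polynomial `p` of degree at most `n`, and normalization says `p(1) = 1`. So `2(1 - x)p(x)`
vanishes at `1` with slope `-2`, and its sup norm on `[-1, 1]` is to be minimized. The minimizer is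
a multiple of `T_{n+1}` stretched so that its largest root sits at `1`; it equioscillates at `n + 1`
points of `[-1, 1)`.

If another kernel does at least as well, the difference of the two polynomials alternates weakly in
sign at these points together with its zero at `1`. That makes `n + 2` points for degree at most
`n`, so it vanishes at all of them (`eval_eq_zero_of_alternating`). There the real part of the
symbol exhausts the bound, so the imaginary part is zero. The symbols thus agree at enough points of
the unit circle to force `u = optimalKernel n` (`eq_of_symbol_arccos_eq`), with no prior
symmetrization of `u`. The lower bound follows from this uniqueness. -/

theorem hasSum_sq (f : EllTwo) : HasSum (fun k => f k ^ 2) (‖f‖ ^ 2) := by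
  have h := lp.hasSum_norm (p := 2) (by norm_num) f
  simpa using h

/-- The Fourier symbol `∑ u(l) e^{-ilθ}` of a kernel. -/
def symbol {n : ℕ} (u : Kernel n) (θ : ℝ) : ℂ :=
  ∑ l, (u l : ℂ) * Complex.exp (-((l : ℤ) * θ * Complex.I))

theorem norm_exp_sub_one_sq (θ : ℝ) :
    ‖Complex.exp (θ * Complex.I) - 1‖ ^ 2 = 2 - 2 * Real.cos θ := by
  rw [← Complex.normSq_eq_norm_sq, Complex.normSq_apply]
  simp only [Complex.sub_re, Complex.sub_im, Complex.exp_ofReal_mul_I_re,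
    Complex.exp_ofReal_mul_I_im, Complex.one_re, Complex.one_im]
  nlinarith [Real.sin_sq_add_cos_sq θ]

open MeasureTheory AddCircle

theorem fourierCoeff_trigPolynomial_mul {T : ℝ} [Fact (0 < T)] {ι : Type*} [Fintype ι]
    (c : ι → ℂ) (m : ι → ℤ) {F : AddCircle T → ℂ} (hF : Integrable F haarAddCircle) (k : ℤ) :
    fourierCoeff (fun t => (∑ i, c i * fourier (m i) t) * F t) k =
      ∑ i, c i * fourierCoeff F (k - m i) := by
  have h1 : (fun t => (∑ i, c i * fourier (m i) t) * F t) =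
      ∑ i, c i • (fun t => fourier (m i) t • F t) := by
    ext t
    simp [Finset.sum_mul, mul_assoc]
  rw [h1, fourierCoeff.sum _ _ fun i _ => (hF.fourier_smul (m i)).smul (c i), Finset.sum_apply]
  refine Finset.sum_congr rfl fun i _ => ?_
  rw [fourierCoeff.const_smul, smul_eq_mul]
  congr 1
  refine integral_congr_ae (Filter.Eventually.of_forall fun t => ?_)
  simp only [smul_eq_mul]
  rw [← mul_assoc, ← fourier_add]
  congr 3
  ring

/-- By Parseval, `f` is the coefficient sequence of some `F` in `L²` of the circle. Convolution
becomes multiplication of `F` by a trigonometric polynomial, and the pointwise bound on it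
integrates. -/
theorem norm_le_of_multiplier_le {T : ℝ} [Fact (0 < T)] {ι : Type*} [Fintype ι]
    (c : ι → ℝ) (m : ι → ℤ) {C : ℝ} (hC : 0 ≤ C)
    (hm : ∀ t : AddCircle T, ‖∑ i, (c i : ℂ) * fourier (m i) t‖ ≤ C) (f : EllTwo) (g : EllTwo)
    (hg : ∀ k, g k = ∑ i, c i * f (k - m i)) : ‖g‖ ≤ C * ‖f‖ := by
  have hfc : Memℓp (fun k => (f k : ℂ)) 2 := by
    refine memℓp_gen ?_
    simpa using (hasSum_sq f).summable
  let F : Lp ℂ 2 (@haarAddCircle T _) := (fourierBasis (T := T)).repr.symm ⟨_, hfc⟩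
  have hF (k : ℤ) : fourierCoeff F k = f k := by
    rw [← fourierBasis_repr]
    simp [F]
  have hFL : MemLp F 2 (@haarAddCircle T _) := Lp.memLp F
  have hFi : Integrable F (@haarAddCircle T _) := hFL.integrable (by norm_num)
  let D : AddCircle T → ℂ := fun t => ∑ i, (c i : ℂ) * fourier (m i) t
  have hD : Continuous D := by
    refine continuous_finsetSum _ fun i _ => continuous_const.mul (map_continuous _)
  let H : AddCircle T → ℂ := fun t => D t * F t
  have hle (t) : ‖H t‖ ≤ C * ‖F t‖ := by
    simp only [H, norm_mul]
    gcongr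
    exact hm t
  have hH : MemLp H 2 (@haarAddCircle T _) :=
    hFL.of_le_mul (hD.aestronglyMeasurable.mul hFL.1) (Filter.Eventually.of_forall hle)
  have hHc (k : ℤ) : fourierCoeff (hH.toLp H) k = g k := by
    rw [fourierCoeff_congr_ae hH.coeFn_toLp, fourierCoeff_trigPolynomial_mul _ _ hFi, hg]
    simp [hF]
  have s1 := hasSum_sq_fourierCoeff F
  have s2 := hasSum_sq_fourierCoeff (hH.toLp H)
  simp only [hF, hHc, Complex.norm_real, Real.norm_eq_abs, sq_abs] at s1 s2
  have e1 := s1.unique (hasSum_sq f)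
  have e2 := s2.unique (hasSum_sq g)
  have e3 : ∫ t, ‖(hH.toLp H) t‖ ^ 2 ∂(@haarAddCircle T _) = ∫ t, ‖H t‖ ^ 2 ∂haarAddCircle := by
    refine integral_congr_ae ?_
    filter_upwards [hH.coeFn_toLp] with t ht
    rw [ht]
  have e4 : ∫ t, ‖H t‖ ^ 2 ∂(@haarAddCircle T _) ≤ ∫ t, C ^ 2 * ‖F t‖ ^ 2 ∂haarAddCircle := by
    refine integral_mono (hH.integrable_norm_pow (p := 2) (by norm_num))
      ((hFL.integrable_norm_pow (p := 2) (by norm_num)).const_mul _) fun t => ?_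
    simp only
    rw [← mul_pow]
    exact pow_le_pow_left₀ (norm_nonneg _) (hle t) 2
  rw [integral_const_mul, e1, ← e3, e2, ← mul_pow] at e4
  exact le_of_sq_le_sq e4 (by positivity)

/-- If the symbol of `f ↦ Δ(u ∗ f)` is bounded by `C`, then so is the operator norm. -/
theorem norm_smoothedLaplacian_le {n : ℕ} (u : Kernel n) {C : ℝ} (hC : 0 ≤ C)
    (h : ∀ θ : ℝ, (2 - 2 * Real.cos θ) * ‖symbol u θ‖ ≤ C) (f : EllTwo) :
    ‖smoothedLaplacian u f‖ ≤ C * ‖f‖ := by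
  have : Fact (0 < 2 * Real.pi) := ⟨by positivity⟩
  refine norm_le_of_multiplier_le (T := 2 * Real.pi) (ι := Finset.Icc (-(n : ℤ)) n × Fin 3)
    (fun p => u p.1 * ![1, -2, 1] p.2) (fun p => p.1 - ![2, 1, 0] p.2) hC ?_ f _ ?_
  · intro t
    induction t using QuotientAddGroup.induction_on with | H x => ?_
    -- The sign flips because `fourier m` is `e^{imx}` while `symbol` is built from `e^{-ilθ}`.
    refine le_trans (le_of_eq ?_) (h (-x))
    have hE (m : ℤ) : (fourier m (x : AddCircle (2 * Real.pi)) : ℂ) =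
        Complex.exp (m * x * Complex.I) := by
      rw [fourier_coe_apply]
      congr 1
      push_cast
      field_simp
    have hs : ∑ p : Finset.Icc (-(n : ℤ)) n × Fin 3,
        ((u p.1 * ![1, -2, 1] p.2 : ℝ) : ℂ) *
          fourier ((p.1 : ℤ) - ![2, 1, 0] p.2) (x : AddCircle (2 * Real.pi)) =
        (Complex.exp (-x * Complex.I) - 1) ^ 2 * symbol u (-x) := by
      rw [Fintype.sum_prod_type, symbol, Finset.mul_sum]
      refine Finset.sum_congr rfl fun l _ => ?_
      simp only [hE, Fin.sum_univ_three, Matrix.cons_val]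
      push_cast
      have e2 : Complex.exp (((l : ℤ) - 2 : ℂ) * x * Complex.I) =
          Complex.exp ((l : ℤ) * x * Complex.I) * Complex.exp (-x * Complex.I) ^ 2 := by
        rw [← Complex.exp_nat_mul, ← Complex.exp_add]
        congr 1; push_cast; ring
      have e1 : Complex.exp (((l : ℤ) - 1 : ℂ) * x * Complex.I) =
          Complex.exp ((l : ℤ) * x * Complex.I) * Complex.exp (-x * Complex.I) := by
        rw [← Complex.exp_add]
        congr 1; ring
      rw [e2, e1, show -((l : ℤ) * (-x : ℂ) * Complex.I) = (l : ℤ) * x * Complex.I by ring]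
      ring_nf
    rw [hs, norm_mul, norm_pow]
    congr 1
    have := norm_exp_sub_one_sq (-x)
    push_cast at this
    exact this
  · intro k
    rw [Fintype.sum_prod_type]
    simp only [smoothedLaplacian, laplacian, conv]
    rw [Finset.mul_sum, ← Finset.sum_sub_distrib, ← Finset.sum_add_distrib]
    refine Finset.sum_congr rfl fun l _ => ?_
    simp only [Fin.sum_univ_three, Matrix.cons_val]
    rw [show k + 2 - (l : ℤ) = k - (l - 2) by ring, show k + 1 - (l : ℤ) = k - (l - 1) by ring,
      show k - (l : ℤ) = k - (l - 0) by ring]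
    ring

/-- The restriction of a sequence to `{0, …, N - 1}`. -/
def truncation (N : ℕ) (g : ℤ → ℝ) : EllTwo :=
  ⟨fun k => if k ∈ Finset.Ico 0 (N : ℤ) then g k else 0, by
    refine memℓp_gen (summable_of_ne_finset_zero (s := Finset.Ico 0 (N : ℤ)) fun k hk => ?_)
    simp only [if_neg hk]
    simp⟩

theorem norm_truncation_sq (N : ℕ) (g : ℤ → ℝ) :
    ‖truncation N g‖ ^ 2 = ∑ k ∈ Finset.Ico 0 (N : ℤ), g k ^ 2 := by
  refine (hasSum_sq _).unique ?_
  have h := hasSum_sum_of_ne_finset_zero (L := SummationFilter.unconditional ℤ) (s := Finset.Ico 0 (N : ℤ))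
    (f := fun k => truncation N g k ^ 2) (fun k hk => by simp only [truncation, if_neg hk]; simp)
  convert! h using 1
  exact Finset.sum_congr rfl fun k hk => by simp only [truncation, if_pos hk]

/-- The value at `k` only involves `g` on `[k - n, k + n + 2]`, which the hypotheses keep inside
`[0, N)`. -/
theorem laplacian_conv_truncation {n : ℕ} (u : Kernel n) (N : ℕ) (g : ℤ → ℝ) {k : ℤ}
    (h1 : n ≤ k) (h2 : k + n + 2 < N) :
    smoothedLaplacian u (truncation N g) k = laplacian (conv u g) k := by
  have h (j : ℤ) (hj : 0 ≤ j) (hj' : j ≤ 2) :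
      conv u (truncation N g) (k + j) = conv u g (k + j) := by
    refine Finset.sum_congr rfl fun l _ => ?_
    have hl := Finset.mem_Icc.1 l.2
    simp only [truncation]
    rw [if_pos (Finset.mem_Ico.2 ⟨by omega, by omega⟩)]
  have h0 := h 0 le_rfl (by norm_num)
  rw [add_zero] at h0
  simp only [smoothedLaplacian, laplacian]
  rw [h 2 (by norm_num) le_rfl, h 1 (by norm_num) (by norm_num), h0]

/-- Exponentials are eigenfunctions; cosine and sine waves appear separately because the operator
acts on real sequences. -/
theorem laplacian_conv_exp {n : ℕ} (u : Kernel n) (θ : ℝ) (k : ℤ) :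
    ((laplacian (conv u fun j => (Complex.exp (j * θ * Complex.I)).re) k : ℝ) : ℂ) +
      (laplacian (conv u fun j => (Complex.exp (j * θ * Complex.I)).im) k : ℝ) * Complex.I =
    (Complex.exp (θ * Complex.I) - 1) ^ 2 * symbol u θ * Complex.exp (k * θ * Complex.I) := by
  have h (j : ℤ) : ((conv u (fun j => (Complex.exp (j * θ * Complex.I)).re) j : ℝ) : ℂ) +
      (conv u (fun j => (Complex.exp (j * θ * Complex.I)).im) j : ℝ) * Complex.I =
      symbol u θ * Complex.exp (j * θ * Complex.I) := by
    simp only [conv, symbol]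
    push_cast
    rw [Finset.sum_mul, Finset.sum_mul, ← Finset.sum_add_distrib]
    refine Finset.sum_congr rfl fun l _ => ?_
    rw [mul_assoc (u l : ℂ) _ Complex.I, ← mul_add, Complex.re_add_im,
      mul_assoc (u l : ℂ) (Complex.exp _) (Complex.exp _), ← Complex.exp_add]
    congr 2
    ring
  simp only [laplacian]
  push_cast
  have e2 : Complex.exp ((k + 2 : ℂ) * θ * Complex.I) =
      Complex.exp (k * θ * Complex.I) * Complex.exp (θ * Complex.I) ^ 2 := by
    rw [← Complex.exp_nat_mul, ← Complex.exp_add]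
    congr 1; push_cast; ring
  have e1 : Complex.exp ((k + 1 : ℂ) * θ * Complex.I) =
      Complex.exp (k * θ * Complex.I) * Complex.exp (θ * Complex.I) := by
    rw [← Complex.exp_add]
    congr 1; ring
  have h0 := h k
  have h1 := h (k + 1)
  have h2 := h (k + 2)
  push_cast at h1 h2
  rw [e1] at h1
  rw [e2] at h2
  linear_combination h2 - 2 * h1 + h0

/-- The operator norm of `f ↦ Δ(u ∗ f)` bounds its symbol. -/
theorem symbol_le_of_norm_smoothedLaplacian_le {n : ℕ} (u : Kernel n) {C : ℝ} (hC : 0 ≤ C)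
    (h : ∀ f, ‖smoothedLaplacian u f‖ ≤ C * ‖f‖) (θ : ℝ) :
    (2 - 2 * Real.cos θ) * ‖symbol u θ‖ ≤ C := by
  set m : ℂ := (Complex.exp (θ * Complex.I) - 1) ^ 2 * symbol u θ with hm
  have hmn : ‖m‖ = (2 - 2 * Real.cos θ) * ‖symbol u θ‖ := by
    rw [hm, norm_mul, norm_pow, norm_exp_sub_one_sq]
  rw [← hmn]
  let a : ℤ → ℝ := fun j => (Complex.exp (j * θ * Complex.I)).re
  let b : ℤ → ℝ := fun j => (Complex.exp (j * θ * Complex.I)).im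
  have hone (k : ℤ) : ‖Complex.exp (k * θ * Complex.I)‖ = 1 := by
    have := Complex.norm_exp_ofReal_mul_I (k * θ)
    push_cast at this
    exact this
  have hab (k : ℤ) : a k ^ 2 + b k ^ 2 = 1 := by
    have := Complex.sq_norm (Complex.exp (k * θ * Complex.I))
    rw [hone, Complex.normSq_apply] at this
    simp only [a, b]
    linarith
  have hsum (k : ℤ) : laplacian (conv u a) k ^ 2 + laplacian (conv u b) k ^ 2 = ‖m‖ ^ 2 := by
    have h1 := congrArg (fun z : ℂ => ‖z‖ ^ 2) (laplacian_conv_exp u θ k)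
    simp only [norm_mul _ (Complex.exp (k * θ * Complex.I)), hone, mul_one] at h1
    rw [hm, ← h1, ← Complex.normSq_eq_norm_sq, Complex.normSq_add_mul_I]
  have hpart (N : ℕ) (g : ℤ → ℝ) :
      ∑ k ∈ Finset.Ico (n : ℤ) (N - n - 2), laplacian (conv u g) k ^ 2 ≤
        C ^ 2 * ∑ k ∈ Finset.Ico 0 (N : ℤ), g k ^ 2 := by
    rw [← norm_truncation_sq, ← mul_pow]
    refine le_trans ?_ (pow_le_pow_left₀ (norm_nonneg _) (h (truncation N g)) 2)
    refine le_trans (le_of_eq ?_) (sum_le_hasSum (Finset.Ico (n : ℤ) (N - n - 2))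
      (fun _ _ => sq_nonneg _) (hasSum_sq (smoothedLaplacian u (truncation N g))))
    refine Finset.sum_congr rfl fun k hk => ?_
    have := Finset.mem_Ico.1 hk
    rw [laplacian_conv_truncation u N g this.1 (by omega)]
  -- The squares of the cosine and sine inputs sum to `1` at each index, those of the outputs to
  -- `‖m‖ ^ 2`. Truncation loses only `2n + 2` indices at the ends, which is negligible as `N`
  -- grows.
  have key (N : ℕ) : ((N : ℝ) - 2 * n - 2) * ‖m‖ ^ 2 ≤ C ^ 2 * N := by
    have h1 := add_le_add (hpart N a) (hpart N b)
    rw [← mul_add, ← Finset.sum_add_distrib, ← Finset.sum_add_distrib] at h1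
    simp only [hab, hsum, Finset.sum_const, Int.card_Ico, nsmul_eq_mul, mul_one, sub_zero,
      Int.toNat_natCast] at h1
    refine le_trans (mul_le_mul_of_nonneg_right ?_ (sq_nonneg _)) h1
    have h2 : (N : ℤ) - 2 * n - 2 ≤ (((N : ℤ) - n - 2 - n).toNat : ℤ) :=
      le_trans (by omega) (Int.self_le_toNat _)
    exact_mod_cast h2
  refine le_of_sq_le_sq ?_ hC
  by_contra hlt
  push Not at hlt
  obtain ⟨N, hN⟩ := exists_nat_gt ((2 * n + 2) * ‖m‖ ^ 2 / (‖m‖ ^ 2 - C ^ 2))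
  rw [div_lt_iff₀ (by linarith)] at hN
  nlinarith [key N]

end Operator

/-! ### Chebyshev expansions over symmetric indices. -/

section Polynomials

open Polynomial Polynomial.Chebyshev MeasureTheory

/-- The coefficients of a polynomial in the family `T_l`, `l ∈ ℤ`, symmetric in `l`. -/
def chebyshevCoeff (l : ℤ) (p : ℝ[X]) : ℝ :=
  1 / Real.pi * ∫ x, p.eval x * (T ℝ |l|).eval x ∂measureT

theorem chebyshevCoeff_add (l : ℤ) (p q : ℝ[X]) :
    chebyshevCoeff l (p + q) = chebyshevCoeff l p + chebyshevCoeff l q := by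
  simp only [chebyshevCoeff, eval_add, add_mul]
  rw [integral_add (integrable_measureT (by fun_prop)) (integrable_measureT (by fun_prop)), mul_add]

theorem chebyshevCoeff_C_mul (l : ℤ) (c : ℝ) (p : ℝ[X]) :
    chebyshevCoeff l (C c * p) = c * chebyshevCoeff l p := by
  simp only [chebyshevCoeff, eval_mul, eval_C, mul_assoc]
  rw [integral_const_mul]
  ring

theorem T_abs (l : ℤ) : T ℝ |l| = T ℝ l := by
  rw [Int.abs_eq_natAbs, T_natAbs]

theorem integral_T (l : ℤ) :
    ∫ x, (T ℝ l).eval x ∂measureT = if l = 0 then Real.pi else 0 := by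
  split_ifs with h
  · rw [h, integral_eval_T_real_measureT_zero]
  · exact integral_eval_T_real_measureT_of_ne_zero h

/-- For `k = 0` both indicators fire, so the weight `1/π` suits every index once the sum runs over
both signs of `l`. -/
theorem chebyshevCoeff_T (l k : ℤ) :
    chebyshevCoeff l (T ℝ k) = ((if l = -k then 1 else 0) + (if l = k then 1 else 0)) / 2 := by
  rw [chebyshevCoeff, T_abs, integral_eval_T_real_mul_eval_T_real_measureT, integral_T, integral_T]
  have h1 : (k + l = 0) ↔ (l = -k) := by omega
  have h2 : (k - l = 0) ↔ (l = k) := by omega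
  simp only [h1, h2]
  have := Real.pi_ne_zero
  split_ifs <;> field_simp <;> ring

theorem sum_chebyshevCoeff_mul_T_self {n : ℕ} {k : ℤ} (hk : |k| ≤ n) :
    ∑ l ∈ Finset.Icc (-(n : ℤ)) n, C (chebyshevCoeff l (T ℝ k)) * T ℝ l = T ℝ k := by
  have hk' := abs_le.1 hk
  have h (l : ℤ) : C (chebyshevCoeff l (T ℝ k)) * T ℝ l =
      (if l = -k then C (1 / 2) * T ℝ k else 0) + (if l = k then C (1 / 2) * T ℝ k else 0) := by
    rw [chebyshevCoeff_T, add_div, C_add, add_mul]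
    congr 1
    · split_ifs with h
      · rw [h, T_neg]
      · simp
    · split_ifs with h
      · rw [h]
      · simp
  simp only [h]
  rw [Finset.sum_add_distrib, Finset.sum_ite_eq', Finset.sum_ite_eq',
    if_pos (Finset.mem_Icc.2 ⟨by omega, by omega⟩), if_pos (Finset.mem_Icc.2 hk'), ← add_mul,
    ← C_add]
  norm_num

/-- The expansion of a polynomial in Chebyshev polynomials. -/
theorem sum_chebyshevCoeff_mul_T {n : ℕ} (m : ℕ) (hm : m ≤ n) {p : ℝ[X]} (hp : p.natDegree ≤ m) :
    ∑ l ∈ Finset.Icc (-(n : ℤ)) n, C (chebyshevCoeff l p) * T ℝ l = p := by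
  have hT (k : ℕ) (hk : k ≤ n) (c : ℝ) : ∑ l ∈ Finset.Icc (-(n : ℤ)) n,
      C (chebyshevCoeff l (C c * T ℝ k)) * T ℝ l = C c * T ℝ k := by
    simp only [chebyshevCoeff_C_mul, Polynomial.C_mul, mul_assoc]
    rw [← Finset.mul_sum, sum_chebyshevCoeff_mul_T_self (by simpa using hk)]
  -- The degree bound `m` is kept apart from `n` so that the summation range stays fixed while
  -- leading terms are removed.
  induction m generalizing p with
  | zero =>
    have h := hT 0 hm (p.coeff 0)
    rwa [Nat.cast_zero, T_zero, mul_one, ← eq_C_of_natDegree_le_zero hp] at h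
  | succ m ih =>
    have hlc : (T ℝ ((m + 1 : ℕ) : ℤ)).coeff (m + 1) ≠ 0 := by
      have h1 : (T ℝ ((m + 1 : ℕ) : ℤ)).natDegree = m + 1 := by
        rw [natDegree_T, Int.natAbs_natCast]
      have h2 := leadingCoeff_ne_zero.2 (T_ne_zero ℝ ((m + 1 : ℕ) : ℤ))
      rwa [leadingCoeff, h1] at h2
    set c := p.coeff (m + 1) / (T ℝ ((m + 1 : ℕ) : ℤ)).coeff (m + 1) with hc
    set q := p - C c * T ℝ ((m + 1 : ℕ) : ℤ) with hq
    have hqd : q.natDegree ≤ m := by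
      refine natDegree_le_iff_coeff_eq_zero.2 fun N hN => ?_
      rcases Nat.lt_or_ge (m + 1) N with h | h
      · rw [hq, coeff_sub, coeff_C_mul, coeff_eq_zero_of_natDegree_lt (by omega),
          coeff_eq_zero_of_natDegree_lt (by rw [natDegree_T, Int.natAbs_natCast]; omega)]
        simp
      · obtain rfl : N = m + 1 := by omega
        rw [hq, coeff_sub, coeff_C_mul, hc]
        field_simp
        simp
    have hp' : p = q + C c * T ℝ ((m + 1 : ℕ) : ℤ) := by rw [hq]; ring
    have h1 := ih (by omega) hqd
    have h2 := hT (m + 1) hm c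
    conv_rhs => rw [hp', ← h1, ← h2]
    rw [← Finset.sum_add_distrib]
    refine Finset.sum_congr rfl fun l _ => ?_
    rw [← add_mul, ← C_add, ← chebyshevCoeff_add, ← hp']

/-! ### The stretched Chebyshev polynomial and the optimal kernel. -/

/-- `cos (π / (2n + 2))`, the largest root of `T_{n+1}`. -/
def largestRoot (n : ℕ) : ℝ := Real.cos (Real.pi / (2 * n + 2))

theorem angle_mem (n : ℕ) : 0 < Real.pi / (2 * n + 2) ∧ Real.pi / (2 * n + 2) ≤ Real.pi / 2 := by
  have := Real.pi_pos
  refine ⟨by positivity, ?_⟩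
  gcongr
  linarith [(Nat.cast_nonneg n : (0 : ℝ) ≤ n)]

theorem largestRoot_nonneg (n : ℕ) : 0 ≤ largestRoot n :=
  Real.cos_nonneg_of_mem_Icc ⟨by linarith [angle_mem n, Real.pi_pos], (angle_mem n).2⟩

theorem largestRoot_le_one (n : ℕ) : largestRoot n ≤ 1 := Real.cos_le_one _

theorem sin_angle_pos (n : ℕ) : 0 < Real.sin (Real.pi / (2 * n + 2)) :=
  Real.sin_pos_of_pos_of_lt_pi (angle_mem n).1 (by linarith [angle_mem n, Real.pi_pos])

/-- The optimal constant. -/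
def optimalConstant (n : ℕ) : ℝ :=
  4 / ((n : ℝ) + 1) *
    (Real.sin (Real.pi / (2 * n + 2)) / (1 + Real.cos (Real.pi / (2 * n + 2))))

theorem optimalConstant_pos (n : ℕ) : 0 < optimalConstant n := by
  have := sin_angle_pos n
  have : 0 ≤ Real.cos (Real.pi / (2 * n + 2)) := largestRoot_nonneg n
  unfold optimalConstant
  positivity

/-- The stretched Chebyshev polynomial `T_{n+1}((1 + c)/2 (x + 1) - 1)`, which vanishes at `1`. -/
def stretchedT (n : ℕ) : ℝ[X] :=
  (T ℝ ((n : ℤ) + 1)).comp (C ((1 + largestRoot n) / 2) * (X + 1) - 1)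

theorem eval_stretchedT (n : ℕ) (x : ℝ) : (stretchedT n).eval x =
    (T ℝ ((n : ℤ) + 1)).eval ((1 + largestRoot n) / 2 * (x + 1) - 1) := by
  simp [stretchedT, eval_comp]

theorem eval_stretchedT_one (n : ℕ) : (stretchedT n).eval 1 = 0 := by
  rw [eval_stretchedT, show (1 + largestRoot n) / 2 * (1 + 1) - 1 = largestRoot n by ring,
    largestRoot, T_real_cos]
  push_cast
  rw [show ((n : ℝ) + 1) * (Real.pi / (2 * n + 2)) = Real.pi / 2 by field_simp]
  exact Real.cos_pi_div_two

/-- With `φ = π/(2n+2)`, `T' = (n+1) U_n` and `U_n(cos φ) sin φ = sin((n+1)φ) = 1`. This slope is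
what makes `optimalPoly n` equal to `1` at `1`. -/
theorem eval_derivative_stretchedT_one (n : ℕ) : (derivative (stretchedT n)).eval 1 *
    Real.sin (Real.pi / (2 * n + 2)) = (1 + largestRoot n) / 2 * (n + 1) := by
  have h : (U ℝ (n : ℤ)).eval (largestRoot n) * Real.sin (Real.pi / (2 * n + 2)) = 1 := by
    rw [largestRoot, U_real_cos]
    push_cast
    rw [show ((n : ℝ) + 1) * (Real.pi / (2 * n + 2)) = Real.pi / 2 by field_simp]
    exact Real.sin_pi_div_two
  rw [stretchedT, derivative_comp, T_derivative_eq_U]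
  simp only [eval_mul, eval_comp, derivative_sub, derivative_mul, derivative_C, derivative_add,
    derivative_X, derivative_one, eval_sub, eval_add, eval_C, eval_X, eval_one, eval_zero,
    add_sub_cancel_right, eval_intCast]
  rw [show (1 + largestRoot n) / 2 * (1 + 1) - 1 = largestRoot n by ring]
  push_cast
  linear_combination (1 + largestRoot n) / 2 * (n + 1) * h

theorem natDegree_stretchedT_le (n : ℕ) : (stretchedT n).natDegree ≤ n + 1 := by
  refine natDegree_comp_le.trans ?_
  rw [natDegree_T]
  have : (C ((1 + largestRoot n) / 2) * (X + 1) - 1 : ℝ[X]).natDegree ≤ 1 := by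
    compute_degree
  calc _ ≤ ((n : ℤ) + 1).natAbs * 1 := Nat.mul_le_mul_left _ this
    _ ≤ n + 1 := by omega

/-- The polynomial that agrees with `S n` away from `1`. -/
def optimalPoly (n : ℕ) : ℝ[X] := C (optimalConstant n / 2) * (stretchedT n /ₘ (X - C 1))

theorem sub_one_mul_optimalPoly (n : ℕ) :
    (X - C 1) * optimalPoly n = C (optimalConstant n / 2) * stretchedT n := by
  have := mul_divByMonic_eq_iff_isRoot.2 (eval_stretchedT_one n)
  rw [optimalPoly, mul_left_comm, this]

theorem eval_optimalPoly (n : ℕ) (x : ℝ) :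
    (x - 1) * (optimalPoly n).eval x = optimalConstant n / 2 * (stretchedT n).eval x := by
  have := congrArg (eval x) (sub_one_mul_optimalPoly n)
  simpa using this

theorem natDegree_optimalPoly_le (n : ℕ) : (optimalPoly n).natDegree ≤ n := by
  refine (natDegree_C_mul_le _ _).trans ?_
  rw [natDegree_divByMonic _ (monic_X_sub_C 1), natDegree_X_sub_C]
  have := natDegree_stretchedT_le n
  omega

theorem eval_optimalPoly_one (n : ℕ) : (optimalPoly n).eval 1 = 1 := by
  have h := congrArg (fun p => (derivative p).eval 1) (sub_one_mul_optimalPoly n)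
  simp only [derivative_mul, derivative_sub, derivative_X, derivative_C, eval_add, eval_mul,
    eval_sub, eval_X, eval_C, eval_one, eval_zero] at h
  have h2 := eval_derivative_stretchedT_one n
  have h3 := sin_angle_pos n
  have h4 : (0 : ℝ) < 1 + largestRoot n := by linarith [largestRoot_nonneg n]
  have h5 : (derivative (stretchedT n)).eval 1 =
      (1 + largestRoot n) / 2 * (n + 1) / Real.sin (Real.pi / (2 * n + 2)) := by
    rw [eq_div_iff h3.ne', h2]
  rw [h5] at h
  have h6 : optimalConstant n = 4 / ((n : ℝ) + 1) *
    (Real.sin (Real.pi / (2 * n + 2)) / (1 + largestRoot n)) := rfl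
  rw [h6] at h
  have h7 : (n : ℝ) + 1 ≠ 0 := by positivity
  generalize Real.sin (Real.pi / (2 * n + 2)) = s at h h3
  field_simp at h
  linarith

theorem S_eq_eval_optimalPoly (n : ℕ) {x : ℝ} (hx : x ≠ 1) : S n x = (optimalPoly n).eval x := by
  have h1 : x - 1 ≠ 0 := sub_ne_zero.2 hx
  refine mul_left_cancel₀ h1 ?_
  rw [eval_optimalPoly, eval_stretchedT]
  simp only [S, optimalConstant, largestRoot]
  field_simp
  ring

theorem optimalKernel_eq (n : ℕ) (l : Finset.Icc (-(n : ℤ)) n) :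
    optimalKernel n l = chebyshevCoeff l (optimalPoly n) := by
  rw [optimalKernel, chebyshevCoeff, integral_measureT]
  congr 1
  refine intervalIntegral.integral_congr_ae ?_
  -- At `x = 1` division by zero makes `S n` vanish while the polynomial is `1`; a single point is
  -- null.
  have : ∀ᵐ x : ℝ, x ≠ 1 := by simp [ae_iff]
  filter_upwards [this] with x hx _
  rw [S_eq_eval_optimalPoly n hx, div_eq_mul_inv, Real.sqrt_inv]

theorem sum_optimalKernel_mul_T (n : ℕ) (x : ℝ) :
    ∑ l, optimalKernel n l * (T ℝ l).eval x = (optimalPoly n).eval x := by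
  simp only [optimalKernel_eq]
  rw [Finset.sum_coe_sort (Finset.Icc (-(n : ℤ)) n)
    (fun l => chebyshevCoeff l (optimalPoly n) * (T ℝ l).eval x)]
  conv_rhs => rw [← sum_chebyshevCoeff_mul_T n le_rfl (natDegree_optimalPoly_le n)]
  simp [eval_finsetSum]

theorem optimalKernel_isNormalized (n : ℕ) : (optimalKernel n).IsNormalized := by
  have := sum_optimalKernel_mul_T n 1
  rw [eval_optimalPoly_one] at this
  simpa [Kernel.IsNormalized] using this

theorem re_symbol {n : ℕ} (u : Kernel n) (θ : ℝ) :
    (symbol u θ).re = ∑ l, u l * (T ℝ l).eval (Real.cos θ) := by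
  rw [symbol, Complex.re_sum]
  refine Finset.sum_congr rfl fun l _ => ?_
  rw [Complex.re_ofReal_mul, T_real_cos, ← neg_mul,
    show -((l : ℤ) * (θ : ℂ)) = ((-((l : ℤ) * θ) : ℝ) : ℂ) by push_cast; ring,
    Complex.exp_ofReal_mul_I_re, Real.cos_neg]

theorem im_symbol {n : ℕ} (u : Kernel n) (θ : ℝ) :
    (symbol u θ).im = -∑ l, u l * Real.sin ((l : ℤ) * θ) := by
  rw [symbol, Complex.im_sum, ← Finset.sum_neg_distrib]
  refine Finset.sum_congr rfl fun l _ => ?_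
  rw [Complex.im_ofReal_mul, ← neg_mul,
    show -((l : ℤ) * (θ : ℂ)) = ((-((l : ℤ) * θ) : ℝ) : ℂ) by push_cast; ring,
    Complex.exp_ofReal_mul_I_im, Real.sin_neg, mul_neg]

/-- The coefficients are even in `l`, so the sine part cancels under `l ↦ -l`. -/
theorem symbol_optimalKernel (n : ℕ) (θ : ℝ) :
    symbol (optimalKernel n) θ = (optimalPoly n).eval (Real.cos θ) := by
  refine Complex.ext ?_ ?_
  · rw [re_symbol, sum_optimalKernel_mul_T, Complex.ofReal_re]
  · rw [im_symbol, Complex.ofReal_im, neg_eq_zero]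
    simp only [optimalKernel_eq]
    rw [Finset.sum_coe_sort (Finset.Icc (-(n : ℤ)) n)
      (fun l => chebyshevCoeff l (optimalPoly n) * Real.sin (l * θ))]
    have h : ∑ l ∈ Finset.Icc (-(n : ℤ)) n, chebyshevCoeff l (optimalPoly n) * Real.sin (l * θ) =
        ∑ l ∈ Finset.Icc (-(n : ℤ)) n, -(chebyshevCoeff l (optimalPoly n) * Real.sin (l * θ)) := by
      refine Finset.sum_bij' (fun l _ => -l) (fun l _ => -l) ?_ ?_ (by simp) (by simp) ?_
      · intro l hl
        have := Finset.mem_Icc.1 hl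
        exact Finset.mem_Icc.2 ⟨by omega, by omega⟩
      · intro l hl
        have := Finset.mem_Icc.1 hl
        exact Finset.mem_Icc.2 ⟨by omega, by omega⟩
      · intro l _
        simp [chebyshevCoeff]
    rw [Finset.sum_neg_distrib] at h
    linarith

theorem two_sub_two_cos_mul_norm_symbol_optimalKernel (n : ℕ) (θ : ℝ) :
    (2 - 2 * Real.cos θ) * ‖symbol (optimalKernel n) θ‖ =
      optimalConstant n * |(stretchedT n).eval (Real.cos θ)| := by
  rw [symbol_optimalKernel, Complex.norm_real, Real.norm_eq_abs]
  have h0 : 0 ≤ 2 - 2 * Real.cos θ := by linarith [Real.cos_le_one θ]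
  have h1 := eval_optimalPoly n (Real.cos θ)
  rw [← abs_of_nonneg h0, ← abs_of_pos (optimalConstant_pos n), ← abs_mul, ← abs_mul,
    ← abs_neg]
  congr 1
  linear_combination 2 * h1

/-- The stretch maps `[-1, 1]` into `[-1, largestRoot n]`, where `T_{n+1}` is at most `1` in
modulus. -/
theorem symbol_optimalKernel_le (n : ℕ) (θ : ℝ) :
    (2 - 2 * Real.cos θ) * ‖symbol (optimalKernel n) θ‖ ≤ optimalConstant n := by
  rw [two_sub_two_cos_mul_norm_symbol_optimalKernel, eval_stretchedT]
  refine mul_le_of_le_one_right (optimalConstant_pos n).le (abs_eval_T_real_le_one _ ?_)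
  have h1 := Real.neg_one_le_cos θ
  have h2 := Real.cos_le_one θ
  have h3 := largestRoot_nonneg n
  have h4 := largestRoot_le_one n
  rw [abs_le]
  constructor <;> nlinarith

/-! ### Sign alternation, and recovery of a kernel from its symbol. -/

/-- Exactly the `i` factors with `j < i` are negative. -/
theorem zero_lt_neg_one_pow_mul_prod_sub {m : ℕ} {x : ℕ → ℝ}
    (hx : StrictAntiOn x (Finset.range (m + 1))) {i : ℕ} (hi : i ≤ m) :
    0 < (-1) ^ i * ∏ j ∈ (Finset.range (m + 1)).erase i, (x i - x j) := by
  have hlt {a b : ℕ} (hb : b ≤ m) (hab : a < b) : x b < x a :=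
    hx (by simp; omega) (by simp; omega) hab
  have h₁ : 0 < ∏ j ∈ Finset.range i, ((-1) * (x i - x j)) :=
    Finset.prod_pos fun j hj => mul_pos_of_neg_of_neg neg_one_lt_zero <|
      sub_neg.2 <| hlt hi (Finset.mem_range.1 hj)
  rw [Finset.prod_mul_distrib, Finset.prod_const, Finset.card_range] at h₁
  have h₂ : 0 < ∏ j ∈ Finset.Ioc i m, (x i - x j) :=
    Finset.prod_pos fun j hj => sub_pos.2 <|
      hlt (Finset.mem_Ioc.1 hj).2 (Finset.mem_Ioc.1 hj).1
  have union : (Finset.range (m + 1)).erase i = Finset.range i ∪ Finset.Ioc i m := by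
    ext j
    simp only [Finset.mem_erase, Finset.mem_range, Finset.mem_union, Finset.mem_Ioc]
    omega
  have disjoint : Disjoint (Finset.range i) (Finset.Ioc i m) := by
    rw [Finset.disjoint_left]
    intro j hj hj'
    simp only [Finset.mem_range, Finset.mem_Ioc] at hj hj'
    omega
  rw [union, Finset.prod_union disjoint, ← mul_assoc]
  exact mul_pos h₁ h₂

/-- A polynomial of degree at most `n` whose values alternate weakly in sign at `n + 2` nodes
vanishes at these nodes. -/
theorem eval_eq_zero_of_alternating {n : ℕ} {x : ℕ → ℝ}
    (hx : StrictAntiOn x (Finset.range (n + 1 + 1))) {p : ℝ[X]} (hp : p.natDegree ≤ n)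
    (h : ∀ i ≤ n + 1, 0 ≤ (-1) ^ i * p.eval (x i)) {i : ℕ} (hi : i ≤ n + 1) :
    p.eval (x i) = 0 := by
  have hdeg : p.degree < (Finset.range (n + 1 + 1)).card := by
    rw [Finset.card_range]
    exact lt_of_le_of_lt degree_le_natDegree (by exact_mod_cast (by omega))
  -- The coefficient of `X^(n+1)` is zero by degree, yet Lagrange interpolation writes it as a sum
  -- of terms that alternation makes nonnegative; hence each term vanishes.
  have hsum := Lagrange.coeff_eq_sum hx.injOn hdeg
  rw [Finset.card_range, Nat.add_sub_cancel, coeff_eq_zero_of_natDegree_lt (by omega)] at hsum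
  have hterm (j : ℕ) (hj : j ∈ Finset.range (n + 1 + 1)) :
      0 ≤ p.eval (x j) / ∏ k ∈ (Finset.range (n + 1 + 1)).erase j, (x j - x k) := by
    have hj' : j ≤ n + 1 := by simp at hj; omega
    have h1 := h j hj'
    have h2 := zero_lt_neg_one_pow_mul_prod_sub hx hj'
    rw [← mul_div_mul_left _ _ (pow_ne_zero j (neg_ne_zero.2 (one_ne_zero (α := ℝ))))]
    exact div_nonneg h1 h2.le
  have h0 := (Finset.sum_eq_zero_iff_of_nonneg hterm).1 hsum.symm i (by simp; omega)
  rcases div_eq_zero_iff.1 h0 with h1 | h1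
  · exact h1
  · have h2 := zero_lt_neg_one_pow_mul_prod_sub hx hi
    rw [h1, mul_zero] at h2
    exact absurd h2 (lt_irrefl _)

/-- The polynomial `∑ u(l) X^{l + n}`. -/
def kernelPoly {n : ℕ} (u : Kernel n) : ℂ[X] :=
  ∑ l, C (u l : ℂ) * X ^ ((l : ℤ) + n).toNat

theorem natDegree_kernelPoly_le {n : ℕ} (u : Kernel n) : (kernelPoly u).natDegree ≤ 2 * n := by
  refine natDegree_sum_le_of_forall_le _ _ fun l _ => (natDegree_C_mul_X_pow_le _ _).trans ?_
  have := Finset.mem_Icc.1 l.2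
  omega

theorem coeff_kernelPoly {n : ℕ} (u : Kernel n) (l : Finset.Icc (-(n : ℤ)) n) :
    (kernelPoly u).coeff ((l : ℤ) + n).toNat = u l := by
  rw [kernelPoly, finsetSum_coeff, Finset.sum_eq_single l]
  · simp
  · intro k _ hk
    rw [coeff_C_mul_X_pow, if_neg]
    intro h
    have h1 := Finset.mem_Icc.1 l.2
    have h2 := Finset.mem_Icc.1 k.2
    exact hk (Subtype.ext (by omega))
  · simp

theorem eval_kernelPoly {n : ℕ} (u : Kernel n) (θ : ℝ) :
    (kernelPoly u).eval (Complex.exp (-(θ * Complex.I))) =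
      Complex.exp (-(n * θ * Complex.I)) * symbol u θ := by
  rw [kernelPoly, eval_finsetSum, symbol, Finset.mul_sum]
  refine Finset.sum_congr rfl fun l _ => ?_
  have h1 := Finset.mem_Icc.1 l.2
  have h2 : ((((l : ℤ) + n).toNat : ℕ) : ℂ) = ((l : ℤ) + n : ℂ) := by
    have : ((((l : ℤ) + n).toNat : ℕ) : ℤ) = (l : ℤ) + n := Int.toNat_of_nonneg (by omega)
    exact_mod_cast congrArg (Int.cast (R := ℂ)) this
  rw [eval_mul, eval_C, eval_pow, eval_X, ← Complex.exp_nat_mul, h2, mul_left_comm,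
    ← Complex.exp_add]
  congr 2
  ring

theorem symbol_neg {n : ℕ} (u : Kernel n) (θ : ℝ) :
    symbol u (-θ) = (starRingEnd ℂ) (symbol u θ) := by
  refine Complex.ext ?_ ?_
  · rw [Complex.conj_re, re_symbol, re_symbol, Real.cos_neg]
  · rw [Complex.conj_im, im_symbol, im_symbol, neg_neg, ← Finset.sum_neg_distrib]
    simp

/-- A kernel is determined by the values of its symbol at `n + 1` points of `[0, π)`. -/
theorem eq_of_symbol_arccos_eq {n : ℕ} {u v : Kernel n} {x : ℕ → ℝ}
    (hx : StrictAntiOn x (Finset.range (n + 1 + 1))) (hx0 : x 0 ≤ 1) (hxn : -1 ≤ x (n + 1))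
    (h : ∀ i ≤ n, symbol u (Real.arccos (x i)) = symbol v (Real.arccos (x i))) : u = v := by
  have hlt {a b : ℕ} (hb : b ≤ n + 1) (hab : a < b) : x b < x a :=
    hx (by simp; omega) (by simp; omega) hab
  have hle (i : ℕ) (hi : i ≤ n) : x i ≤ 1 := by
    rcases Nat.eq_zero_or_pos i with rfl | hi'
    · exact hx0
    · exact (hlt (by omega) hi').le.trans hx0
  have hgt (i : ℕ) (hi : i ≤ n) : -1 < x i := hxn.trans_lt (hlt le_rfl (by omega))
  let z : ℕ → ℂ := fun i => Complex.exp (-(Real.arccos (x i) * Complex.I))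
  let z' : ℕ → ℂ := fun i => Complex.exp (-((-Real.arccos (x i) : ℝ) * Complex.I))
  have hre (θ : ℝ) : (Complex.exp (-(θ * Complex.I))).re = Real.cos θ := by
    rw [← neg_mul, ← Complex.ofReal_neg, Complex.exp_ofReal_mul_I_re, Real.cos_neg]
  have him (θ : ℝ) : (Complex.exp (-(θ * Complex.I))).im = -Real.sin θ := by
    rw [← neg_mul, ← Complex.ofReal_neg, Complex.exp_ofReal_mul_I_im, Real.sin_neg]
  have hzre (i : ℕ) (hi : i ≤ n) : (z i).re = x i := by
    rw [hre, Real.cos_arccos (hgt i hi).le (hle i hi)]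
  have hzre' (i : ℕ) (hi : i ≤ n) : (z' i).re = x i := by
    rw [hre, Real.cos_neg, Real.cos_arccos (hgt i hi).le (hle i hi)]
  have hxinj {i j : ℕ} (hi : i ≤ n) (hj : j ≤ n) (hij : x i = x j) : i = j :=
    hx.injOn (by simp; omega) (by simp; omega) hij
  -- The conjugate points `z'` start at `i = 1` because `x 0` may be `1`, whose point is its own
  -- conjugate. The resulting `2n + 1` points exceed the degree `2n` of `kernelPoly`.
  set s := (Finset.range (n + 1)).image z ∪ (Finset.Icc 1 n).image z' with hs
  have hcard : s.card = 2 * n + 1 := by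
    rw [hs, Finset.card_union_of_disjoint, Finset.card_image_of_injOn, Finset.card_image_of_injOn,
      Finset.card_range, Nat.card_Icc]
    · omega
    · intro i hi j hj hij
      simp only [Finset.coe_Icc, Set.mem_Icc] at hi hj
      refine hxinj hi.2 hj.2 ?_
      rw [← hzre' i hi.2, ← hzre' j hj.2]
      exact congrArg Complex.re hij
    · intro i hi j hj hij
      simp only [Finset.coe_range, Set.mem_Iio] at hi hj
      refine hxinj (by omega) (by omega) ?_
      rw [← hzre i (by omega), ← hzre j (by omega)]
      exact congrArg Complex.re hij
    · rw [Finset.disjoint_left]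
      intro w hw hw'
      obtain ⟨i, hi, rfl⟩ := Finset.mem_image.1 hw
      obtain ⟨j, hj, hij⟩ := Finset.mem_image.1 hw'
      have hj' := Finset.mem_Icc.1 hj
      have h1 : (z i).im ≤ 0 := by
        rw [him, neg_nonpos]
        exact Real.sin_nonneg_of_mem_Icc ⟨Real.arccos_nonneg _, Real.arccos_le_pi _⟩
      have h2 : 0 < (z' j).im := by
        rw [him, Real.sin_neg, neg_neg, Real.sin_arccos]
        refine Real.sqrt_pos.2 ?_
        have := hgt j hj'.2
        have := hlt (a := 0) (b := j) (by omega) (by omega)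
        nlinarith
      rw [hij] at h2
      linarith
  have hzero : kernelPoly u - kernelPoly v = 0 := by
    refine eq_zero_of_natDegree_lt_card_of_eval_eq_zero' _ s ?_ ?_
    · intro w hw
      rw [eval_sub, sub_eq_zero]
      rcases Finset.mem_union.1 hw with hw | hw
      · obtain ⟨i, hi, rfl⟩ := Finset.mem_image.1 hw
        have := Finset.mem_range.1 hi
        simp only [z]
        rw [eval_kernelPoly, eval_kernelPoly, h i (by omega)]
      · obtain ⟨i, hi, rfl⟩ := Finset.mem_image.1 hw
        have := Finset.mem_Icc.1 hi
        simp only [z']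
        rw [eval_kernelPoly, eval_kernelPoly, symbol_neg, symbol_neg, h i (by omega)]
    · refine lt_of_le_of_lt (natDegree_sub_le _ _) ?_
      have := natDegree_kernelPoly_le u
      have := natDegree_kernelPoly_le v
      omega
  ext l
  have h1 := coeff_kernelPoly u l
  rw [sub_eq_zero.1 hzero, coeff_kernelPoly] at h1
  exact_mod_cast h1.symm

/-! ### Extremal nodes and uniqueness of the optimal kernel. -/

/-- The point `1` followed by the extremal points of `stretchedT n` in `[-1, 1)`. -/
def extremalNode (n i : ℕ) : ℝ :=
  if i = 0 then 1 else (node (n + 1) i + 1) * 2 / (1 + largestRoot n) - 1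

/-- The stretch keeps every extremal point of `T_{n+1}` except the one at `1`, since `cos(π/(n+1)) <
cos(π/(2n+2))`. -/
theorem node_lt_largestRoot {n i : ℕ} (h0 : i ≠ 0) (hi : i ≤ n + 1) :
    node (n + 1) i < largestRoot n := by
  have hn : node (n + 1) i ≤ node (n + 1) 1 :=
    (strictAntiOn_node (n + 1)).antitoneOn (by simp) (by simp; omega) (by omega)
  refine hn.trans_lt ?_
  have := Real.pi_pos
  refine Real.cos_lt_cos_of_nonneg_of_le_pi (angle_mem n).1.le ?_ ?_
  · rw [Nat.cast_one, one_mul]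
    refine div_le_self Real.pi_pos.le ?_
    push_cast
    linarith [(Nat.cast_nonneg n : (0 : ℝ) ≤ n)]
  · push_cast
    rw [one_mul]
    refine div_lt_div_of_pos_left Real.pi_pos (by positivity) ?_
    linarith [(Nat.cast_nonneg n : (0 : ℝ) ≤ n)]

theorem extremalNode_lt_one {n i : ℕ} (h0 : i ≠ 0) (hi : i ≤ n + 1) : extremalNode n i < 1 := by
  have := node_lt_largestRoot h0 hi
  have h1 := largestRoot_nonneg n
  rw [extremalNode, if_neg h0, sub_lt_iff_lt_add, div_lt_iff₀ (by linarith)]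
  linarith

theorem neg_one_le_extremalNode (n i : ℕ) : -1 ≤ extremalNode n i := by
  have h1 := largestRoot_nonneg n
  have h2 := (node_mem_Icc (n := n + 1) (i := i)).1
  rw [extremalNode]
  split_ifs
  · norm_num
  · have : 0 ≤ (node (n + 1) i + 1) * 2 / (1 + largestRoot n) :=
      div_nonneg (by linarith) (by linarith)
    linarith

theorem strictAntiOn_extremalNode (n : ℕ) :
    StrictAntiOn (extremalNode n) (Finset.range (n + 1 + 1)) := by
  intro i hi j hj hij
  simp only [Finset.coe_range, Set.mem_Iio] at hi hj
  rcases Nat.eq_zero_or_pos i with rfl | h0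
  · rw [extremalNode.eq_def n 0, if_pos rfl]
    exact extremalNode_lt_one (by omega) (by omega)
  · have h1 := largestRoot_nonneg n
    have h2 : node (n + 1) j < node (n + 1) i := node_lt (by omega) hij
    rw [extremalNode, if_neg (by omega), extremalNode, if_neg (by omega)]
    gcongr

theorem eval_stretchedT_extremalNode {n i : ℕ} (h0 : i ≠ 0) (hi : i ≤ n + 1) :
    (stretchedT n).eval (extremalNode n i) = (-1) ^ i := by
  have h1 := largestRoot_nonneg n
  have h2 : (1 + largestRoot n) / 2 * (extremalNode n i + 1) - 1 = node (n + 1) i := by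
    rw [extremalNode, if_neg h0]
    have : (1 + largestRoot n) ≠ 0 := by linarith
    field_simp
    ring
  have h3 := eval_T_real_node (n := n + 1) (Finset.mem_Iic.2 hi)
  rw [eval_stretchedT, h2]
  push_cast at h3
  exact h3

/-- The kernel `optimalKernel n` is the only normalized kernel whose symbol is that small. -/
theorem eq_optimalKernel_of_symbol_le {n : ℕ} {u : Kernel n} (hu : u.IsNormalized)
    (h : ∀ θ : ℝ, (2 - 2 * Real.cos θ) * ‖symbol u θ‖ ≤ optimalConstant n) :
    u = optimalKernel n := by
  set d : ℝ[X] := ∑ l, C (u l) * T ℝ l - optimalPoly n with hd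
  have hM := optimalConstant_pos n
  have hdeg : d.natDegree ≤ n := by
    refine (natDegree_sub_le _ _).trans (max_le ?_ (natDegree_optimalPoly_le n))
    refine natDegree_sum_le_of_forall_le _ _ fun l _ => (natDegree_C_mul_le _ _).trans ?_
    have := Finset.mem_Icc.1 l.2
    rw [natDegree_T]
    omega
  have heval (θ : ℝ) : d.eval (Real.cos θ) =
      (symbol u θ).re - (optimalPoly n).eval (Real.cos θ) := by
    rw [re_symbol, hd, eval_sub, eval_finsetSum]
    simp
  have hone : extremalNode n 0 = 1 := if_pos rfl
  have hcos (i : ℕ) (hi : i ≤ n + 1) :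
      Real.cos (Real.arccos (extremalNode n i)) = extremalNode n i := by
    refine Real.cos_arccos (neg_one_le_extremalNode n i) ?_
    rcases eq_or_ne i 0 with rfl | h0
    · exact hone.le
    · exact (extremalNode_lt_one h0 hi).le
  have hpoly (i : ℕ) (h0 : i ≠ 0) (hi : i ≤ n + 1) :
      (2 - 2 * extremalNode n i) * (optimalPoly n).eval (extremalNode n i) =
        -(optimalConstant n * (-1) ^ i) := by
    have h1 := eval_optimalPoly n (extremalNode n i)
    rw [eval_stretchedT_extremalNode h0 hi] at h1
    linear_combination -2 * h1
  have hdzero (i : ℕ) (hi : i ≤ n + 1) : d.eval (extremalNode n i) = 0 := by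
    -- At `1` both polynomials equal `1`. At the other nodes `optimalPoly n` takes the extreme
    -- allowed value with sign `-(-1)^i`, so the difference has weak sign `(-1)^i`.
    refine eval_eq_zero_of_alternating (strictAntiOn_extremalNode n) hdeg (fun i hi => ?_) hi
    rcases eq_or_ne i 0 with rfl | h0
    · have hu' : ∑ l, u l = 1 := hu
      rw [hone, hd, eval_sub, eval_finsetSum, eval_optimalPoly_one]
      simp only [eval_mul, eval_C, T_eval_one, mul_one]
      rw [hu']
      simp
    · have hx := extremalNode_lt_one h0 hi
      have h1 := h (Real.arccos (extremalNode n i))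
      have h2 := heval (Real.arccos (extremalNode n i))
      have h3 := hpoly i h0 hi
      rw [hcos i hi] at h1 h2
      have h4 := Complex.abs_re_le_norm (symbol u (Real.arccos (extremalNode n i)))
      set r := (symbol u (Real.arccos (extremalNode n i))).re
      have h5 : (2 - 2 * extremalNode n i) * |r| ≤ optimalConstant n :=
        (mul_le_mul_of_nonneg_left h4 (by linarith)).trans h1
      have h6 : -|r| ≤ (-1) ^ i * r := by
        refine (abs_le.1 (le_of_eq ?_)).1
        rw [abs_mul, abs_neg_one_pow, one_mul]
      have h7 : ((-1 : ℝ) ^ i) * (-1) ^ i = 1 := by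
        rw [← mul_pow]
        norm_num
      refine nonneg_of_mul_nonneg_right (a := 2 - 2 * extremalNode n i) ?_ (by linarith)
      have h8 : (2 - 2 * extremalNode n i) * ((-1) ^ i * d.eval (extremalNode n i)) =
          (2 - 2 * extremalNode n i) * ((-1) ^ i * r) + optimalConstant n := by
        rw [h2]
        linear_combination -(-1) ^ i * h3 + optimalConstant n * h7
      have h9 := mul_le_mul_of_nonneg_left h6 (by linarith : 0 ≤ 2 - 2 * extremalNode n i)
      rw [h8]
      linarith
  refine eq_of_symbol_arccos_eq (strictAntiOn_extremalNode n) hone.le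
    (neg_one_le_extremalNode n _) fun i hi => ?_
  have hre : (symbol u (Real.arccos (extremalNode n i))).re =
      (optimalPoly n).eval (extremalNode n i) := by
    have h1 := heval (Real.arccos (extremalNode n i))
    rw [hcos i (by omega), hdzero i (by omega)] at h1
    linarith
  rw [symbol_optimalKernel, hcos i (by omega), ← hre]
  refine Complex.ext (by simp) ?_
  rw [Complex.ofReal_im]
  rcases eq_or_ne i 0 with rfl | h0
  · rw [hone, Real.arccos_one, im_symbol]
    simp
  -- The real part alone attains the bound on the modulus, which leaves no room for an imaginary
  -- part.
  · have hx := extremalNode_lt_one h0 (by omega : i ≤ n + 1)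
    have h1 := h (Real.arccos (extremalNode n i))
    rw [hcos i (by omega)] at h1
    have h2 := congrArg abs (hpoly i h0 (by omega))
    rw [abs_mul, abs_neg, abs_mul, abs_neg_one_pow, mul_one, abs_of_pos hM,
      abs_of_pos (by linarith : 0 < 2 - 2 * extremalNode n i), ← hre] at h2
    rw [← h2] at h1
    have h3 := le_of_mul_le_mul_left h1 (by linarith : 0 < 2 - 2 * extremalNode n i)
    exact Complex.abs_re_eq_norm.1 (le_antisymm (Complex.abs_re_le_norm _) h3)

/-! ### From symbol bounds to the smoothing constant. -/

/-- A crude bound, needed only for finiteness: `sSup` of an unbounded set of reals is `0` by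
convention. -/
theorem exists_norm_smoothedLaplacian_le {n : ℕ} (u : Kernel n) :
    ∃ C, 0 ≤ C ∧ ∀ f, ‖smoothedLaplacian u f‖ ≤ C * ‖f‖ := by
  refine ⟨4 * ∑ l, |u l|, by positivity, norm_smoothedLaplacian_le u (by positivity) fun θ => ?_⟩
  refine mul_le_mul (by linarith [Real.neg_one_le_cos θ]) ?_ (norm_nonneg _) (by norm_num)
  refine (norm_sum_le _ _).trans (Finset.sum_le_sum fun l _ => ?_)
  rw [norm_mul, Complex.norm_real, Real.norm_eq_abs, ← neg_mul,
    show -((l : ℤ) * (θ : ℂ)) = ((-((l : ℤ) * θ) : ℝ) : ℂ) by push_cast; ring,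
    Complex.norm_exp_ofReal_mul_I, mul_one]

theorem bddAbove_ratios {n : ℕ} (u : Kernel n) : BddAbove (ratios u) := by
  obtain ⟨C, -, hC⟩ := exists_norm_smoothedLaplacian_le u
  refine ⟨C, ?_⟩
  rintro r ⟨f, hf, rfl⟩
  exact (div_le_iff₀ (norm_pos_iff.2 hf)).2 (hC f)

theorem smoothingConstant_nonneg {n : ℕ} (u : Kernel n) : 0 ≤ smoothingConstant u := by
  refine Real.sSup_nonneg ?_
  rintro r ⟨f, -, rfl⟩
  positivity

theorem norm_smoothedLaplacian_le_smoothingConstant {n : ℕ} (u : Kernel n) (f : EllTwo) :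
    ‖smoothedLaplacian u f‖ ≤ smoothingConstant u * ‖f‖ := by
  rcases eq_or_ne f 0 with rfl | hf
  · obtain ⟨C, -, hC⟩ := exists_norm_smoothedLaplacian_le u
    simpa using hC 0
  · exact (div_le_iff₀ (norm_pos_iff.2 hf)).1 (le_csSup (bddAbove_ratios u) ⟨f, hf, rfl⟩)

theorem smoothingConstant_le {n : ℕ} (u : Kernel n) {C : ℝ} (hC : 0 ≤ C)
    (h : ∀ f, ‖smoothedLaplacian u f‖ ≤ C * ‖f‖) : smoothingConstant u ≤ C := by
  refine Real.sSup_le ?_ hC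
  rintro r ⟨f, hf, rfl⟩
  exact (div_le_iff₀ (norm_pos_iff.2 hf)).2 (h f)

theorem eq_optimalKernel_of_smoothingConstant_le {n : ℕ} {u : Kernel n} (hu : u.IsNormalized)
    (h : smoothingConstant u ≤ optimalConstant n) : u = optimalKernel n :=
  eq_optimalKernel_of_symbol_le hu fun θ =>
    (symbol_le_of_norm_smoothedLaplacian_le u (smoothingConstant_nonneg u)
      (norm_smoothedLaplacian_le_smoothingConstant u) θ).trans h

theorem smoothingConstant_optimalKernel_le (n : ℕ) :
    smoothingConstant (optimalKernel n) ≤ optimalConstant n :=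
  smoothingConstant_le _ (optimalConstant_pos n).le
    (norm_smoothedLaplacian_le _ (optimalConstant_pos n).le (symbol_optimalKernel_le n))

/-- The bound is attained at `θ = π`: the stretch fixes `-1`, where `T_{n+1}` is `±1`. -/
theorem optimalConstant_le_smoothingConstant_optimalKernel (n : ℕ) :
    optimalConstant n ≤ smoothingConstant (optimalKernel n) := by
  have h := symbol_le_of_norm_smoothedLaplacian_le _ (smoothingConstant_nonneg _)
    (norm_smoothedLaplacian_le_smoothingConstant (optimalKernel n)) Real.pi
  rw [two_sub_two_cos_mul_norm_symbol_optimalKernel, eval_stretchedT, Real.cos_pi,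
    neg_add_cancel, mul_zero, zero_sub, T_eval_neg_one] at h
  simpa using h

/-- A kernel with a smaller constant would have to be `optimalKernel n`, whose constant is not
smaller. -/
theorem optimalConstant_le_smoothingConstant {n : ℕ} {u : Kernel n} (hu : u.IsNormalized) :
    optimalConstant n ≤ smoothingConstant u := by
  by_contra! hlt
  have h := optimalConstant_le_smoothingConstant_optimalKernel n
  rw [← eq_optimalKernel_of_smoothingConstant_le hu hlt.le] at h
  exact absurd h (not_le.2 hlt)

end Polynomials

end SmoothestAverage

end

theorem theorem1 (n : ℕ) :
    (SmoothestAverage.optimalKernel n).IsNormalized ∧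
    ∀ u : SmoothestAverage.Kernel n, u.IsNormalized →
      BddAbove (SmoothestAverage.ratios u) ∧
      4 / ((n : ℝ) + 1) *
          (Real.sin (Real.pi / (2 * n + 2)) / (1 + Real.cos (Real.pi / (2 * n + 2))))
        ≤ SmoothestAverage.smoothingConstant u ∧
      (SmoothestAverage.smoothingConstant u =
          4 / ((n : ℝ) + 1) *
            (Real.sin (Real.pi / (2 * n + 2)) / (1 + Real.cos (Real.pi / (2 * n + 2))))
        ↔ u = SmoothestAverage.optimalKernel n) := by
  refine ⟨SmoothestAverage.optimalKernel_isNormalized n, fun u hu =>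
    ⟨SmoothestAverage.bddAbove_ratios u, SmoothestAverage.optimalConstant_le_smoothingConstant hu,
      fun h => SmoothestAverage.eq_optimalKernel_of_smoothingConstant_le hu h.le, ?_⟩⟩
  rintro rfl
  exact le_antisymm (SmoothestAverage.smoothingConstant_optimalKernel_le n)
    (SmoothestAverage.optimalConstant_le_smoothingConstant hu)
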